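/- **Setting.** Let $\Sigma$ be a finite token space, let $\mathcal X$ be a set of token strings over $\Sigma$ (prompts), let $T\ge 1$, and let $\rho$ be a (discrete) probability distribution on $\mathcal X$. A deterministic model $\pi$ maps every token string to a token. On a prompt $x$ it generates the chain of thought $\pi_{1:T}(x)=(y_1,\dots,y_T)$ with $y_t=\pi(x,y_1,\dots,y_{t-1})$, and its answer is $\pi_T(x)=y_T$. Let $\mathcal V:\mathcal X\times\Sigma\to\{0,1\}$ be an outcome verifier; the accuracy of $f:\mathcal X\to\Sigma$ is $\mathrm{Acc}_\rho(f)=\Pr_{x\sim\rho}(\mathcal V(x,f(x))=1)$. Let $\Pi$ be a class of deterministic models of finite Natarajan dimension $d$ that contains a model $\pi^\star$ with $\mathrm{Acc}_\rho(\pi^\star_T)=1$. A reference model $\pi_{\mathrm{ref}}(\cdot\mid x)$ is a conditional distribution on $\Sigma^T$. For $C_{\mathrm{seq}}\ge 1$ it satisfies *$(C_{\mathrm{seq}},\eta)$ partial sequence-level coverage* if $$\Pr_{x\sim\rho}\big(\pi_{\mathrm{ref}}(\pi^\star_{1:T}(x)\mid x)\ge C_{\mathrm{seq}}^{-1}\big)\ge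 1-\eta .$$ **Algorithm RLFineTune.** Given i.i.d. prompts $x_1,\dots,x_n\sim\rho$: for each $i$, draw $m=\lceil C_{\mathrm{seq}}\log(4nC_{\mathrm{seq}}/\delta)\rceil$ independent responses from $\pi_{\mathrm{ref}}(\cdot\mid x_i)$ (each returned together with its probability), call the verifier on each of them, and let $\widetilde D_i$ be the set of the drawn $y$ with $\mathcal V(x_i,y_T)=1$ and $\pi_{\mathrm{ref}}(y\mid x_i)\ge C_{\mathrm{seq}}^{-1}$. Choose (with arbitrary tie-breaking) $$\widehat\pi\in\arg\min_{\pi\in\Pi}\frac1n\sum_{i=1}^n\mathbf 1\big(\pi_{1:T}(x_i)\notin\widetilde D_i\big)$$ and return the outcome-level model $\widehat f=\widehat\pi_T$. **Theorem (learning with partial sequence-level coverage).** There are absolute constants $C_1,C_2,C_3>0$ such that the following holds in every such setting and for all $\varepsilon,\delta\in(0,1)$. Suppose that $\pi_{\mathrm{ref}}$ satisfies $(C_{\mathrm{seq}},\eta)$ partial sequence-level coverage, that $n\ge 2$, and that $$n\ \ge\ C_1\,\frac{d\,\log(T\,|\Sigma|\,C_{\mathrm{seq}})\,\log n+\log(1/\delta)}{\varepsilon}.$$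 Then, with probability at least $1-\delta$ over the prompts and the rollouts, $\mathrm{Acc}_\rho(\widehat f)\ge 1-C_2(\varepsilon+\eta)$. Furthermore, RLFineTune always generates at most $C_3\,n\,C_{\mathrm{seq}}\log(nC_{\mathrm{seq}}/\delta)$ responses from $\pi_{\mathrm{ref}}$ and calls the verifier at most that many times. -/

import Mathlib

/-! ### Strings, deterministic next-token models, chains of thought -/

/-- Token strings of finite or infinite length. -/
abbrev TokenString (Tok : Type*) := Stream'.Seq Tok

/-- A deterministic next-token predictor: it maps every token prefix to a single token. -/
abbrev NextTokenModel (Tok : Type*) := TokenString Tok → Tok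

/-- Responses: token sequences of length `T`. -/
abbrev Response (Tok : Type*) (T : ℕ) := Fin T → Tok

namespace NextTokenModel

variable {Tok : Type*}

/-- The first `t` tokens `y₁, …, y_t` that are decoded autoregressively on the prompt `x`:
`y_{t+1} = π (x, y₁, …, y_t)`. -/
def decode (π : NextTokenModel Tok) (x : TokenString Tok) : ℕ → List Tok
  | 0 => []
  | t + 1 => decode π x t ++ [π (x.append (Stream'.Seq.ofList (decode π x t)))]

/-- The chain of thought `π_{1:T}(x)`. -/
def cot (π : NextTokenModel Tok) (T : ℕ) (x : TokenString Tok) : Response Tok T :=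
  fun t => π (x.append (Stream'.Seq.ofList (π.decode x t)))

end NextTokenModel

/-- The answer `y_T`, that is, the last token of a response. -/
def Response.answer {Tok : Type*} {T : ℕ} [NeZero T] (y : Response Tok T) : Tok :=
  y ⟨T - 1, Nat.sub_lt (NeZero.pos T) Nat.one_pos⟩

/-- The outcome-level model `π_T`, which answers a prompt by the last token of `π_{1:T}`. -/
def NextTokenModel.outcome {Tok : Type*} (π : NextTokenModel Tok) (T : ℕ) [NeZero T]
    (x : TokenString Tok) : Tok :=
  Response.answer (π.cot T x)

/-! ### Natarajan dimension -/

/-- `S` is shattered, in the sense of Natarajan, by the class `F`. -/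
def NatarajanShatters {α β : Type*} (F : Set (α → β)) (S : Finset α) : Prop :=
  ∃ f₀ f₁ : α → β, (∀ a ∈ S, f₀ a ≠ f₁ a) ∧
    ∀ B ⊆ S, ∃ h ∈ F, (∀ a ∈ B, h a = f₀ a) ∧ ∀ a ∈ S, a ∉ B → h a = f₁ a

/-- The Natarajan dimension: the largest size of a shattered finite set (possibly infinite). -/
noncomputable def natarajanDim {α β : Type*} (F : Set (α → β)) : ℕ∞ :=
  ⨆ (S : Finset α) (_ : NatarajanShatters F S), (S.card : ℕ∞)

/-! ### Probability, accuracy, coverage -/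

/-- The probability of an event under a discrete distribution. -/
noncomputable def PMF.pr {α : Type*} (p : PMF α) (s : Set α) : ℝ :=
  (p.toOuterMeasure s).toReal

/-- The law of `n` i.i.d. draws from `p`. -/
noncomputable def PMF.iid {α : Type*} (p : PMF α) : (n : ℕ) → PMF (Fin n → α)
  | 0 => PMF.pure Fin.elim0
  | n + 1 => p.bind fun a => (PMF.iid p n).map fun v => Fin.cons (α := fun _ => α) a v

section Setting

variable {Tok : Type*} {X : Set (TokenString Tok)}

/-- Accuracy of a (deterministic) outcome-level model `f` with respect to the verifier `V`:
the probability over a prompt drawn from `ρ` that the answer of `f` is accepted. -/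
noncomputable def accuracy (ρ : PMF X) (V : X → Tok → Bool) (f : X → Tok) : ℝ :=
  ρ.pr {x | V x (f x) = true}

/-- The reference model `πref` satisfies `(C, η)` partial sequence-level coverage of the chains of
thought of `πstar` under the prompt distribution `ρ`. -/
def PartialSeqCoverage {T : ℕ} (ρ : PMF X) (πref : X → PMF (Response Tok T))
    (πstar : NextTokenModel Tok) (C η : ℝ) : Prop :=
  1 - η ≤ ρ.pr {x | C⁻¹ ≤ (πref x (πstar.cot T x)).toReal}

end Setting

/-! ### Programs with query access to a reference model and to an outcome verifier -/

/-- Programs that return a value of type `α` and may, on the way,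
* request a response drawn from the reference model on a prompt; the oracle returns the response
  together with its probability under the reference model;
* query the outcome verifier at a prompt and an answer. -/
inductive OracleProg (X Y A : Type*) (α : Type*)
  | pure (a : α) : OracleProg X Y A α
  | rollout (x : X) (k : Y → ℝ → OracleProg X Y A α) : OracleProg X Y A α
  | verify (x : X) (a : A) (k : Bool → OracleProg X Y A α) : OracleProg X Y A α

/-- The result of an execution, with the number of oracle calls made. -/
structure Execution (α : Type*) where
  result : α
  rollouts : ℕ
  verifierCalls : ℕ

namespace OracleProg

variable {X Y A α β : Type*}

/-- Sequential composition of programs. -/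
def bind (p : OracleProg X Y A α) (f : α → OracleProg X Y A β) : OracleProg X Y A β :=
  match p with
  | .pure a => f a
  | .rollout x k => .rollout x fun y q => (k y q).bind f
  | .verify x a k => .verify x a fun b => (k b).bind f

/-- The distribution of the execution of a program: every rollout is a fresh draw from the
reference model, and every call to an oracle is counted. -/
noncomputable def run (πref : X → PMF Y) (V : X → A → Bool) :
    OracleProg X Y A α → PMF (Execution α)
  | .pure a => PMF.pure ⟨a, 0, 0⟩
  | .rollout x k => (πref x).bind fun y =>
      (run πref V (k y (πref x y).toReal)).map fun e =>
        { e with rollouts := e.rollouts + 1 }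
  | .verify x a k => (run πref V (k (V x a))).map fun e =>
        { e with verifierCalls := e.verifierCalls + 1 }

end OracleProg

/-! ### The algorithm `RLFineTune` -/

section RLFineTune

variable {Tok : Type*} {X : Set (TokenString Tok)} {T : ℕ} [NeZero T]

open Classical in
/-- Rejection sampling on the prompt `x`: draw `m` responses from the reference model, call the
verifier on each of them, and return the set of the distinct responses with a correct answer and
with probability at least `C⁻¹` under the reference model. -/
noncomputable def rejectionSample (C : ℝ) (x : X) :
    ℕ → OracleProg X (Response Tok T) Tok (Finset (Response Tok T))
  | 0 => .pure ∅
  | m + 1 => .rollout x fun y q => .verify x y.answer fun b =>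
      (rejectionSample C x m).bind fun D =>
        .pure (if C⁻¹ ≤ q ∧ b = true then insert y D else D)

/-- Rejection sampling on each of the prompts `x₁, …, x_n`. -/
noncomputable def rejectionSampleAll (C : ℝ) (m : ℕ) : {n : ℕ} → (Fin n → X) →
    OracleProg X (Response Tok T) Tok (Fin n → Finset (Response Tok T))
  | 0, _ => .pure Fin.elim0
  | _ + 1, xs => (rejectionSample C (xs 0) m).bind fun D =>
      (rejectionSampleAll C m fun i => xs i.succ).bind fun Ds =>
        .pure (Fin.cons (α := fun _ => Finset (Response Tok T)) D Ds)

open Classical in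
/-- The empirical indicator loss `(1/n) ∑ᵢ 𝟙 (π_{1:T}(xᵢ) ∉ Dᵢ)`. -/
noncomputable def indicatorLoss {n : ℕ} (π : NextTokenModel Tok) (xs : Fin n → X)
    (Ds : Fin n → Finset (Response Tok T)) : ℝ :=
  (∑ i, if π.cot T (xs i) ∈ Ds i then (0 : ℝ) else 1) / n

/-- `erm` is an empirical risk minimizer over the class `M` for the indicator loss, with an
arbitrary rule to break ties. -/
def IsERM {n : ℕ} (M : Set (NextTokenModel Tok))
    (erm : (Fin n → X) → (Fin n → Finset (Response Tok T)) → NextTokenModel Tok) : Prop :=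
  ∀ xs Ds, erm xs Ds ∈ M ∧ ∀ π ∈ M, indicatorLoss (erm xs Ds) xs Ds ≤ indicatorLoss π xs Ds

/-- The number of rollouts per prompt, `⌈C log (4 n C / δ)⌉`. -/
noncomputable def rolloutsPerPrompt (n : ℕ) (C δ : ℝ) : ℕ :=
  ⌈C * Real.log (4 * n * C / δ)⌉₊

/-- `RLFineTune`: rejection sampling on all prompts of the dataset, followed by empirical risk
minimization; the outcome-level model of the minimizer is returned. -/
noncomputable def rlFineTune {n : ℕ}
    (erm : (Fin n → X) → (Fin n → Finset (Response Tok T)) → NextTokenModel Tok)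
    (C δ : ℝ) (xs : Fin n → X) : OracleProg X (Response Tok T) Tok (X → Tok) :=
  (rejectionSampleAll C (rolloutsPerPrompt n C δ) xs).bind fun Ds =>
    .pure fun x => (erm xs Ds).outcome T x

/-- The law of the execution of `RLFineTune` on `n` i.i.d. prompts drawn from `ρ`. -/
noncomputable def rlFineTuneLaw {n : ℕ} (ρ : PMF X) (πref : X → PMF (Response Tok T))
    (V : X → Tok → Bool)
    (erm : (Fin n → X) → (Fin n → Finset (Response Tok T)) → NextTokenModel Tok)
    (C δ : ℝ) : PMF (Execution (X → Tok)) :=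
  (ρ.iid n).bind fun xs => (rlFineTune erm C δ xs).run πref V

end RLFineTune

/-! At most `Cseq` responses to a prompt have probability at least `Cseq⁻¹` under the reference
model, so few responses can be accepted, and which ones does not depend on the class of models.
A model misses a prompt if its chain of thought there is not accepted. This depends only on the
values of the model on the at most `Cseq * T` prefixes of accepted responses, and Natarajan's
lemma on these prefixes bounds the growth function of the sets of missed prompts. By coverage,
`πstar` misses with probability at most `η`, and a model of accuracy below `1 - 20 * (ε + η)`
misses with probability at least `20 * (ε + η)`. Symmetrization by a ghost sample, in which an
exponential weight penalizes misses in the sample and rewards misses in the ghost sample, shows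
that with high probability every such model misses more often on the sample than `πstar`. With
high probability rejection sampling also finds every accepted response, and then the empirical
risk minimizer, which misses at most as often as `πstar`, is none of these models. -/

open scoped ENNReal

section DiscreteProbability

variable {α β : Type*}

/-- The expectation of an extended nonnegative function under a discrete distribution. It is a
plain series, so that no measurable structure is needed on `α`. -/
noncomputable def expectation (p : PMF α) (f : α → ℝ≥0∞) : ℝ≥0∞ := ∑' a, p a * f a

theorem expectation_mono (p : PMF α) {f g : α → ℝ≥0∞} (h : ∀ a, f a ≤ g a) :
    expectation p f ≤ expectation p g :=
  ENNReal.tsum_le_tsum fun a => mul_le_mul_right (h a) _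

@[simp] theorem expectation_const (p : PMF α) (c : ℝ≥0∞) : expectation p (fun _ => c) = c := by
  simp only [expectation, ENNReal.tsum_mul_right, p.tsum_coe, one_mul]

theorem expectation_const_mul (p : PMF α) (c : ℝ≥0∞) (f : α → ℝ≥0∞) :
    expectation p (fun a => c * f a) = c * expectation p f := by
  simp only [expectation, mul_left_comm _ c, ENNReal.tsum_mul_left]

theorem expectation_add (p : PMF α) (f g : α → ℝ≥0∞) :
    expectation p (fun a => f a + g a) = expectation p f + expectation p g := by
  simp only [expectation, mul_add, ENNReal.tsum_add]

theorem expectation_finset_sum {ι : Type*} (p : PMF α) (s : Finset ι) (f : ι → α → ℝ≥0∞) :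
    expectation p (fun a => ∑ i ∈ s, f i a) = ∑ i ∈ s, expectation p (f i) := by
  simp only [expectation, Finset.mul_sum]
  exact Summable.tsum_finsetSum fun _ _ => ENNReal.summable

theorem expectation_bind (p : PMF α) (q : α → PMF β) (f : β → ℝ≥0∞) :
    expectation (p.bind q) f = expectation p fun a => expectation (q a) f := by
  simp only [expectation, PMF.bind_apply, ← ENNReal.tsum_mul_right, ← ENNReal.tsum_mul_left]
  rw [ENNReal.tsum_comm]
  simp only [mul_assoc]

@[simp] theorem expectation_pure (a : α) (f : α → ℝ≥0∞) : expectation (PMF.pure a) f = f a := by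
  rw [expectation, tsum_eq_single a fun b hb => by simp [hb]]
  simp

theorem expectation_map (p : PMF α) (g : α → β) (f : β → ℝ≥0∞) :
    expectation (p.map g) f = expectation p fun a => f (g a) := by
  simp only [PMF.map, expectation_bind, expectation_pure, Function.comp_apply]

theorem expectation_indicator_one (p : PMF α) (s : Set α) :
    expectation p (s.indicator 1) = p.toOuterMeasure s := by
  rw [PMF.toOuterMeasure_apply, expectation]
  exact tsum_congr fun a => by by_cases ha : a ∈ s <;> simp [ha]

theorem toOuterMeasure_ne_top (p : PMF α) (s : Set α) : p.toOuterMeasure s ≠ ∞ := by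
  refine ne_top_of_le_ne_top ENNReal.one_ne_top ?_
  rw [← expectation_indicator_one, ← expectation_const p 1]
  exact expectation_mono p (Set.indicator_le_self' fun _ _ => zero_le)

theorem ofReal_pr (p : PMF α) (s : Set α) :
    ENNReal.ofReal (p.pr s) = expectation p (s.indicator 1) := by
  rw [PMF.pr, ENNReal.ofReal_toReal (toOuterMeasure_ne_top p s), expectation_indicator_one]

theorem ofReal_pr_le_expectation (p : PMF α) {s : Set α} {f : α → ℝ≥0∞} (h : ∀ a ∈ s, 1 ≤ f a) :
    ENNReal.ofReal (p.pr s) ≤ expectation p f := by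
  rw [ofReal_pr]
  exact expectation_mono p fun a => Set.indicator_apply_le' (h a) fun _ => zero_le

theorem pr_nonneg (p : PMF α) (s : Set α) : 0 ≤ p.pr s := ENNReal.toReal_nonneg

@[simp] theorem pr_empty (p : PMF α) : p.pr ∅ = 0 := by simp [PMF.pr]

theorem pr_singleton (p : PMF α) (a : α) : p.pr {a} = (p a).toReal := by
  rw [PMF.pr, PMF.toOuterMeasure_apply_singleton]

theorem pr_add_pr_compl (p : PMF α) (s : Set α) : p.pr s + p.pr sᶜ = 1 := by
  rw [← ENNReal.ofReal_eq_ofReal_iff (add_nonneg (pr_nonneg p s) (pr_nonneg p sᶜ)) zero_le_one,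
    ENNReal.ofReal_add (pr_nonneg p s) (pr_nonneg p sᶜ), ofReal_pr, ofReal_pr, ← expectation_add,
    ENNReal.ofReal_one, ← expectation_const p 1]
  exact congrArg (expectation p) (Set.indicator_self_add_compl s (1 : α → ℝ≥0∞))

theorem pr_le_one (p : PMF α) (s : Set α) : p.pr s ≤ 1 := by
  linarith [pr_add_pr_compl p s, pr_nonneg p sᶜ]

theorem pr_mono (p : PMF α) {s t : Set α} (h : s ∩ p.support ⊆ t) : p.pr s ≤ p.pr t :=
  ENNReal.toReal_mono (toOuterMeasure_ne_top p t) (p.toOuterMeasure_mono h)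

theorem pr_union_le (p : PMF α) (s t : Set α) : p.pr (s ∪ t) ≤ p.pr s + p.pr t := by
  have hs := toOuterMeasure_ne_top p s
  have ht := toOuterMeasure_ne_top p t
  rw [PMF.pr, PMF.pr, PMF.pr, ← ENNReal.toReal_add hs ht]
  exact ENNReal.toReal_mono (ENNReal.add_ne_top.2 ⟨hs, ht⟩)
    (MeasureTheory.measure_union_le s t)

theorem pr_biUnion_finset_le {ι : Type*} (p : PMF α) (I : Finset ι) (s : ι → Set α) :
    p.pr (⋃ i ∈ I, s i) ≤ ∑ i ∈ I, p.pr (s i) := by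
  have hs := fun i (_ : i ∈ I) => toOuterMeasure_ne_top p (s i)
  simp only [PMF.pr]
  rw [← ENNReal.toReal_sum hs]
  exact ENNReal.toReal_mono (ENNReal.sum_ne_top.2 hs)
    (MeasureTheory.measure_biUnion_finset_le I s)

theorem pr_map (p : PMF α) (f : α → β) (s : Set β) : (p.map f).pr s = p.pr (f ⁻¹' s) := by
  rw [PMF.pr, PMF.toOuterMeasure_map_apply, PMF.pr]

theorem pr_bind_le (p : PMF α) (q : α → PMF β) {s : Set β} (B : Set α) {b c : ℝ} (hb : 0 ≤ b)
    (hc : 0 ≤ c) (hB : ∀ a ∈ B, (q a).pr s ≤ b) (hBc : ∀ a ∉ B, (q a).pr s ≤ c) :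
    (p.bind q).pr s ≤ b * p.pr B + c * p.pr Bᶜ := by
  have hb' := mul_nonneg hb (pr_nonneg p B)
  have hc' := mul_nonneg hc (pr_nonneg p Bᶜ)
  rw [← ENNReal.ofReal_le_ofReal_iff (add_nonneg hb' hc'), ENNReal.ofReal_add hb' hc',
    ENNReal.ofReal_mul hb, ENNReal.ofReal_mul hc]
  simp only [ofReal_pr, expectation_bind, ← expectation_const_mul, ← expectation_add]
  refine expectation_mono p fun a => ?_
  rw [← ofReal_pr]
  by_cases ha : a ∈ B
  · simpa [ha] using ENNReal.ofReal_le_ofReal (hB a ha)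
  · simpa [ha] using ENNReal.ofReal_le_ofReal (hBc a ha)

theorem pr_bind_le_add (p : PMF α) (q : α → PMF β) {s : Set β} (B : Set α) {b c : ℝ} (hc : 0 ≤ c)
    (hB : p.pr B ≤ b) (hBc : ∀ a ∉ B, (q a).pr s ≤ c) : (p.bind q).pr s ≤ b + c := by
  have hbind := pr_bind_le p q B zero_le_one hc (fun a _ => pr_le_one (q a) s) hBc
  nlinarith [pr_le_one p Bᶜ]

theorem encard_setOf_inv_le_apply_le (p : PMF α) {C : ℝ} (hC : 0 < C) :
    {a | C⁻¹ ≤ (p a).toReal}.encard ≤ ⌊C⌋₊ := by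
  by_contra! hlt
  obtain ⟨s, hs, hcard⟩ := Set.exists_subset_encard_eq (Order.add_one_le_of_lt hlt)
  have hfin : s.Finite := Set.finite_of_encard_eq_coe (k := ⌊C⌋₊ + 1) (by exact_mod_cast hcard)
  lift s to Finset α using hfin
  rw [Set.encard_coe_eq_coe_finsetCard] at hcard
  have hmass : ∑ a ∈ s, (p a).toReal ≤ 1 := by
    rw [← ENNReal.toReal_sum fun a _ => p.apply_ne_top a]
    exact ENNReal.toReal_le_of_le_ofReal zero_le_one
      (by simpa [p.tsum_coe] using ENNReal.sum_le_tsum (f := p) s)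
  have hle : (s.card : ℝ) * C⁻¹ ≤ ∑ a ∈ s, (p a).toReal := by
    rw [← nsmul_eq_mul]
    exact Finset.card_nsmul_le_sum s _ _ hs
  have hcard' : (s.card : ℝ) = ⌊C⌋₊ + 1 := by exact_mod_cast hcard
  rw [hcard', ← div_eq_mul_inv] at hle
  linarith [(div_le_one hC).1 (hle.trans hmass), Nat.lt_floor_add_one C]

theorem iid_apply (p : PMF α) : ∀ (n : ℕ) (v : Fin n → α), p.iid n v = ∏ i, p (v i)
  | 0, v => by simp [PMF.iid, Subsingleton.elim v Fin.elim0]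
  | n + 1, v => by
    classical
    have hcons : ∀ a w, v = Fin.cons (α := fun _ => α) a w ↔ a = v 0 ∧ w = Fin.tail v := fun a w =>
      ⟨by rintro rfl; simp, by rintro ⟨rfl, rfl⟩; simp⟩
    simp only [PMF.iid, PMF.bind_apply, PMF.map_apply, hcons]
    rw [tsum_eq_single (v 0) fun a ha => by simp [ha],
      tsum_eq_single (Fin.tail v) fun w hw => by simp [hw]]
    simp [iid_apply p n, Fin.prod_univ_succ, Fin.tail]

theorem expectation_iid_prod (p : PMF α) (f : α → ℝ≥0∞) :
    ∀ n : ℕ, expectation (p.iid n) (fun v => ∏ i, f (v i)) = expectation p f ^ n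
  | 0 => by simp [PMF.iid]
  | n + 1 => by
    simp only [PMF.iid, expectation_bind, expectation_map, Fin.prod_univ_succ, Fin.cons_zero,
      Fin.cons_succ, expectation_const_mul, expectation_iid_prod p f n]
    simp only [mul_comm _ (expectation p f ^ n), expectation_const_mul, pow_succ]

theorem expectation_iid_iid (p : PMF α) (n : ℕ) (F : (Fin n → α) → (Fin n → α) → ℝ≥0∞) :
    (expectation (p.iid n) fun v => expectation (p.iid n) fun w => F v w) =
      ∑' z : (Fin n → α) × (Fin n → α), (∏ i, p (z.1 i) * p (z.2 i)) * F z.1 z.2 := by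
  simp only [expectation, iid_apply, Finset.prod_mul_distrib, ← ENNReal.tsum_mul_left, ← mul_assoc]
  exact (ENNReal.tsum_prod (f := fun v w => (∏ i, p (v i)) * (∏ i, p (w i)) * F v w)).symm

theorem expectation_iid_piecewise (p : PMF α) {n : ℕ} (s : Finset (Fin n))
    (F : (Fin n → α) → (Fin n → α) → ℝ≥0∞) :
    (expectation (p.iid n) fun v => expectation (p.iid n) fun w =>
        F (s.piecewise w v) (s.piecewise v w)) =
      expectation (p.iid n) fun v => expectation (p.iid n) fun w => F v w := by
  let swap : (Fin n → α) × (Fin n → α) → (Fin n → α) × (Fin n → α) :=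
    fun z => (s.piecewise z.2 z.1, s.piecewise z.1 z.2)
  have hswap : Function.Involutive swap := fun z => by
    ext i <;> by_cases hi : i ∈ s <;> simp [swap, hi]
  rw [expectation_iid_iid, expectation_iid_iid p n F,
    ← hswap.toPerm.tsum_eq fun z => (∏ i, p (z.1 i) * p (z.2 i)) * F z.1 z.2]
  refine tsum_congr fun z => ?_
  rw [hswap.coe_toPerm]
  congr 1
  refine Finset.prod_congr rfl fun i _ => ?_
  by_cases hi : i ∈ s <;> simp [swap, hi, mul_comm]

end DiscreteProbability

section HitCounts

variable {α : Type*} {n : ℕ}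

/-- The number of coordinates of the sample `v` that lie in the event `A`. -/
noncomputable def hitCount (A : Set α) (v : Fin n → α) : ℕ := ∑ i, A.indicator 1 (v i)

theorem hitCount_congr {A B : Set α} {v : Fin n → α} (h : ∀ i, v i ∈ A ↔ v i ∈ B) :
    hitCount A v = hitCount B v := by
  classical
  exact Finset.sum_congr rfl fun i _ => by simp only [Set.indicator_apply, h i]

theorem prod_pow_indicator_eq (A : Set α) (v : Fin n → α) (c : ℝ) :
    ∏ i, c ^ A.indicator (1 : α → ℕ) (v i) = c ^ hitCount A v :=
  Finset.prod_pow_eq_pow_sum Finset.univ _ c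

theorem expectation_pow_indicator (p : PMF α) (A : Set α) {c : ℝ} (hc : 0 ≤ c) :
    expectation p (fun a => ENNReal.ofReal (c ^ A.indicator (1 : α → ℕ) a)) =
      ENNReal.ofReal (1 + (c - 1) * p.pr A) := by
  have hsum := pr_add_pr_compl p A
  have hsplit : (fun a => ENNReal.ofReal (c ^ A.indicator (1 : α → ℕ) a)) = fun a =>
      ENNReal.ofReal c * A.indicator 1 a + Aᶜ.indicator 1 a := by
    ext a
    by_cases ha : a ∈ A <;> simp [ha]
  rw [hsplit, expectation_add, expectation_const_mul, ← ofReal_pr, ← ofReal_pr,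
    ← ENNReal.ofReal_mul hc, ← ENNReal.ofReal_add (mul_nonneg hc (pr_nonneg p A)) (pr_nonneg p Aᶜ)]
  congr 1
  linarith

theorem expectation_pow_hitCount_le (p : PMF α) (n : ℕ) (A : Set α) {c : ℝ} (hc : 0 ≤ c) :
    expectation (p.iid n) (fun v => ENNReal.ofReal (c ^ hitCount A v)) ≤
      ENNReal.ofReal (Real.exp (n * ((c - 1) * p.pr A))) := by
  simp only [← prod_pow_indicator_eq, ENNReal.ofReal_prod_of_nonneg fun _ _ => pow_nonneg hc _]
  rw [expectation_iid_prod p fun a => ENNReal.ofReal (c ^ A.indicator (1 : α → ℕ) a),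
    expectation_pow_indicator p A hc, Real.exp_nat_mul, ENNReal.ofReal_pow (Real.exp_pos _).le]
  gcongr
  linarith [Real.add_one_le_exp ((c - 1) * p.pr A)]

theorem pr_le_hitCount_mul_log_le (p : PMF α) (n : ℕ) (A : Set α) {c : ℝ} (hc : 0 < c) (t : ℝ) :
    (p.iid n).pr {v | t ≤ hitCount A v * Real.log c} ≤
      Real.exp (n * ((c - 1) * p.pr A) - t) := by
  rw [← ENNReal.ofReal_le_ofReal_iff (Real.exp_pos _).le, sub_eq_neg_add, Real.exp_add,
    ENNReal.ofReal_mul (Real.exp_pos _).le]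
  refine le_trans (ofReal_pr_le_expectation _ fun v (hv : t ≤ _) => ?_) <|
    (expectation_const_mul _ _ _).trans_le <|
      mul_le_mul_right (expectation_pow_hitCount_le p n A hc.le) (ENNReal.ofReal (Real.exp (-t)))
  rw [← ENNReal.ofReal_mul (Real.exp_pos _).le, ← ENNReal.ofReal_one, ← Real.exp_log hc,
    ← Real.exp_nat_mul, ← Real.exp_add]
  exact ENNReal.ofReal_le_ofReal (Real.one_le_exp (by linarith))

theorem pr_lt_hitCount_le (p : PMF α) (n : ℕ) (A : Set α) (s : ℝ) :
    (p.iid n).pr {v | s < hitCount A v} ≤ Real.exp (n * p.pr A - s * Real.log 2) := by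
  calc
    _ ≤ (p.iid n).pr {v | s * Real.log 2 ≤ hitCount A v * Real.log 2} :=
      pr_mono _ fun v hv =>
        mul_le_mul_of_nonneg_right (le_of_lt (show s < hitCount A v from hv.1))
          (Real.log_pos one_lt_two).le
    _ ≤ Real.exp (n * ((2 - 1) * p.pr A) - s * Real.log 2) :=
      pr_le_hitCount_mul_log_le p n A two_pos _
    _ = _ := by congr 1; ring

theorem pr_hitCount_lt_half_le (p : PMF α) {n : ℕ} {A : Set α} {r : ℝ} (hr : r ≤ p.pr A)
    (hnr : 5 ≤ n * r) : (p.iid n).pr {v | (hitCount A v : ℝ) < n * r / 2} ≤ 1 / 2 := by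
  have hlog : (0 : ℝ) < Real.log 2 := Real.log_pos one_lt_two
  have hmul : (n : ℝ) * r ≤ n * p.pr A := mul_le_mul_of_nonneg_left hr n.cast_nonneg
  calc
    _ ≤ (p.iid n).pr {v | -(n * r / 2 * Real.log 2) ≤ hitCount A v * Real.log (1 / 2)} :=
      pr_mono _ fun v hv => by
        have hlt : (hitCount A v : ℝ) < n * r / 2 := hv.1
        change _ ≤ hitCount A v * Real.log (1 / 2)
        rw [one_div, Real.log_inv]
        nlinarith
    _ ≤ Real.exp (n * ((1 / 2 - 1) * p.pr A) - -(n * r / 2 * Real.log 2)) :=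
      pr_le_hitCount_mul_log_le p n A one_half_pos _
    _ ≤ Real.exp (-Real.log 2) := by
      rw [Real.exp_le_exp]
      nlinarith [Real.log_two_lt_d9]
    _ = 1 / 2 := by rw [Real.exp_neg, Real.exp_log two_pos, one_div]

end HitCounts

section UniformDeviation

variable {α : Type*} {n : ℕ}

/-- The growth function of a class of sets: the largest number of distinct traces that the class
leaves on a set of at most `m` points. -/
noncomputable def growthFunction (𝒜 : Set (Set α)) (m : ℕ) : ℕ∞ :=
  ⨆ (S : Finset α) (_ : S.card ≤ m), ((· ∩ (S : Set α)) '' 𝒜).encard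

/-- A weight that favours pairs of samples in which `A` is hit rarely by `v` and often by its ghost
copy `w`. The bases average to one, so that exchanging a random set of coordinates of `v` and `w`
keeps the mean weight at most one. -/
noncomputable def ghostWeight (A : Set α) (v w : Fin n → α) : ℝ :=
  (1 / 2) ^ hitCount A v * (3 / 2) ^ hitCount A w

/-- The largest weight of a pair of samples over a class of events. -/
noncomputable def maxGhostWeight (𝒜 : Set (Set α)) (v w : Fin n → α) : ℝ≥0∞ :=
  ⨆ A ∈ 𝒜, ENNReal.ofReal (ghostWeight A v w)

theorem ghostWeight_nonneg (A : Set α) (v w : Fin n → α) : 0 ≤ ghostWeight A v w := by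
  unfold ghostWeight
  positivity

theorem sum_ghostWeight_piecewise_le (A : Set α) (v w : Fin n → α) :
    ∑ s : Finset (Fin n), ghostWeight A (s.piecewise w v) (s.piecewise v w) ≤ 2 ^ n := by
  classical
  let weight (a b : α) : ℝ :=
    (1 / 2) ^ A.indicator (1 : α → ℕ) a * (3 / 2) ^ A.indicator (1 : α → ℕ) b
  have hprod (v w : Fin n → α) : ghostWeight A v w = ∏ i, weight (v i) (w i) := by
    rw [ghostWeight, ← prod_pow_indicator_eq, ← prod_pow_indicator_eq, ← Finset.prod_mul_distrib]
  have hswap (s : Finset (Fin n)) : ghostWeight A (s.piecewise w v) (s.piecewise v w) =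
      (∏ i ∈ s, weight (w i) (v i)) * ∏ i ∈ sᶜ, weight (v i) (w i) := by
    rw [hprod, ← Finset.prod_mul_prod_compl s]
    congr 1 <;> refine Finset.prod_congr rfl fun i hi => ?_
    · simp [hi]
    · simp [Finset.mem_compl.1 hi]
  have hpair (a b : α) : 0 ≤ weight a b + weight b a ∧ weight a b + weight b a ≤ 2 := by
    by_cases ha : a ∈ A <;> by_cases hb : b ∈ A <;> norm_num [weight, ha, hb]
  simp only [hswap]
  rw [← Fintype.prod_add]
  exact (Finset.prod_le_prod (fun i _ => (hpair _ _).1) fun i _ => (hpair _ _).2).trans_eq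
    (by simp)

theorem exists_finset_traces {𝒜 : Set (Set α)} {N : ℕ} (hN : growthFunction 𝒜 (2 * n) ≤ N)
    (v w : Fin n → α) :
    ∃ traces : Finset (Set α), traces.card ≤ N ∧
      ∀ A ∈ 𝒜, ∃ B ∈ traces, ∀ i, (v i ∈ A ↔ v i ∈ B) ∧ (w i ∈ A ↔ w i ∈ B) := by
  classical
  let S : Finset α := Finset.univ.image v ∪ Finset.univ.image w
  have hS : S.card ≤ 2 * n := by
    rw [two_mul]
    grw [Finset.card_union_le, Finset.card_image_le, Finset.card_image_le, Finset.card_fin]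
  have hcard : ((· ∩ (S : Set α)) '' 𝒜).encard ≤ N :=
    (le_iSup₂ (f := fun (S : Finset α) (_ : S.card ≤ 2 * n) =>
      ((· ∩ (S : Set α)) '' 𝒜).encard) S hS).trans hN
  obtain ⟨traces, htraces⟩ := (Set.finite_of_encard_le_coe hcard).exists_finset_coe
  rw [← htraces, Set.encard_coe_eq_coe_finsetCard, Nat.cast_le] at hcard
  refine ⟨traces, hcard, fun A hA => ⟨A ∩ S, ?_, fun i => by simp [S]⟩⟩
  rw [← Finset.mem_coe, htraces]
  exact Set.mem_image_of_mem _ hA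

theorem ghostWeight_piecewise_congr {A B : Set α} {v w : Fin n → α}
    (h : ∀ i, (v i ∈ A ↔ v i ∈ B) ∧ (w i ∈ A ↔ w i ∈ B)) (s : Finset (Fin n)) :
    ghostWeight A (s.piecewise w v) (s.piecewise v w) =
      ghostWeight B (s.piecewise w v) (s.piecewise v w) := by
  rw [ghostWeight, ghostWeight,
    hitCount_congr fun i => s.piecewise_cases w v (fun a => a ∈ A ↔ a ∈ B) (h i).2 (h i).1,
    hitCount_congr fun i => s.piecewise_cases v w (fun a => a ∈ A ↔ a ∈ B) (h i).1 (h i).2]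

theorem sum_maxGhostWeight_piecewise_le {𝒜 : Set (Set α)} {N : ℕ}
    (hN : growthFunction 𝒜 (2 * n) ≤ N) (v w : Fin n → α) :
    ∑ s : Finset (Fin n), maxGhostWeight 𝒜 (s.piecewise w v) (s.piecewise v w) ≤ 2 ^ n * N := by
  obtain ⟨traces, hcard, htraces⟩ := exists_finset_traces hN v w
  calc
    _ ≤ ∑ s : Finset (Fin n), ∑ B ∈ traces,
        ENNReal.ofReal (ghostWeight B (s.piecewise w v) (s.piecewise v w)) := by
      refine Finset.sum_le_sum fun s _ => iSup₂_le fun A hA => ?_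
      obtain ⟨B, hB, hAB⟩ := htraces A hA
      rw [ghostWeight_piecewise_congr hAB s]
      exact Finset.single_le_sum_of_canonicallyOrdered
        (f := fun B => ENNReal.ofReal (ghostWeight B (s.piecewise w v) (s.piecewise v w))) hB
    _ ≤ ∑ _B ∈ traces, (2 : ℝ≥0∞) ^ n := by
      rw [Finset.sum_comm]
      refine Finset.sum_le_sum fun B _ => ?_
      rw [← ENNReal.ofReal_sum_of_nonneg fun s _ => ghostWeight_nonneg _ _ _]
      exact (ENNReal.ofReal_le_ofReal (sum_ghostWeight_piecewise_le B v w)).trans_eq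
        (by simp [ENNReal.ofReal_pow])
    _ ≤ 2 ^ n * N := by
      rw [Finset.sum_const, nsmul_eq_mul, mul_comm]
      gcongr

theorem expectation_maxGhostWeight_le (p : PMF α) {𝒜 : Set (Set α)} {N : ℕ}
    (hN : growthFunction 𝒜 (2 * n) ≤ N) :
    (expectation (p.iid n) fun v => expectation (p.iid n) fun w => maxGhostWeight 𝒜 v w) ≤ N := by
  have hsum : (2 : ℝ≥0∞) ^ n *
      (expectation (p.iid n) fun v => expectation (p.iid n) fun w => maxGhostWeight 𝒜 v w) ≤
        2 ^ n * N := by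
    calc
      _ = ∑ s : Finset (Fin n), expectation (p.iid n) fun v => expectation (p.iid n) fun w =>
          maxGhostWeight 𝒜 (s.piecewise w v) (s.piecewise v w) := by
        simp [expectation_iid_piecewise p _ (maxGhostWeight 𝒜)]
      _ ≤ 2 ^ n * N := by
        simp only [← expectation_finset_sum]
        grw [expectation_mono _ fun v => expectation_mono _ fun w =>
          sum_maxGhostWeight_piecewise_le hN v w]
        simp only [expectation_const, le_refl]
  exact (ENNReal.mul_le_mul_iff_right (by simp) (by simp)).1 hsum

theorem half_le_expectation_ghostWeight (p : PMF α) {A : Set α} {v : Fin n → α} {r s : ℝ}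
    (hr : r ≤ p.pr A) (hnr : 5 ≤ n * r) (hv : hitCount A v ≤ s) :
    1 / 2 ≤ expectation (p.iid n) fun w =>
      ENNReal.ofReal (Real.exp (s * Real.log 2 - n * r / 2 * Real.log (3 / 2)) *
        ghostWeight A v w) := by
  have hfew := pr_hitCount_lt_half_le p hr hnr
  have hmany : 1 / 2 ≤ (p.iid n).pr {w | (hitCount A w : ℝ) < n * r / 2}ᶜ := by
    linarith [pr_add_pr_compl (p.iid n) {w | (hitCount A w : ℝ) < n * r / 2}]
  calc
    (1 / 2 : ℝ≥0∞) = ENNReal.ofReal (1 / 2) := by simp [ENNReal.ofReal_inv_of_pos]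
    _ ≤ ENNReal.ofReal ((p.iid n).pr {w | (hitCount A w : ℝ) < n * r / 2}ᶜ) :=
      ENNReal.ofReal_le_ofReal hmany
    _ ≤ _ := ofReal_pr_le_expectation _ fun w hw => ENNReal.one_le_ofReal.2 ?_
  have hw : n * r / 2 ≤ (hitCount A w : ℝ) := not_lt.1 hw
  have hlog2 : 0 < Real.log 2 := Real.log_pos one_lt_two
  have hlog : 0 < Real.log (3 / 2) := Real.log_pos (by norm_num)
  have hweight : ghostWeight A v w =
      Real.exp (hitCount A w * Real.log (3 / 2) - hitCount A v * Real.log 2) := by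
    rw [ghostWeight, sub_eq_neg_add, Real.exp_add, ← mul_neg, ← Real.log_inv, Real.exp_nat_mul,
      Real.exp_nat_mul, Real.exp_log (by norm_num), Real.exp_log (by norm_num), one_div]
  rw [hweight, ← Real.exp_add]
  refine Real.one_le_exp ?_
  nlinarith

theorem pr_exists_hitCount_le_le (p : PMF α) {𝒜 : Set (Set α)} {N : ℕ} {r s : ℝ}
    (hN : growthFunction 𝒜 (2 * n) ≤ N) (hnr : 5 ≤ n * r) :
    (p.iid n).pr {v | ∃ A ∈ 𝒜, r ≤ p.pr A ∧ hitCount A v ≤ s} ≤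
      2 * N * Real.exp (s * Real.log 2 - n * r / 2 * Real.log (3 / 2)) := by
  set c := Real.exp (s * Real.log 2 - n * r / 2 * Real.log (3 / 2)) with hc
  have hc0 : 0 ≤ c := (Real.exp_pos _).le
  have hghost : ∀ v ∈ {v : Fin n → α | ∃ A ∈ 𝒜, r ≤ p.pr A ∧ hitCount A v ≤ s},
      1 ≤ ENNReal.ofReal (2 * c) * expectation (p.iid n) fun w => maxGhostWeight 𝒜 v w := by
    rintro v ⟨A, hA, hr, hv⟩
    have hhalf := half_le_expectation_ghostWeight p hr hnr hv
    simp only [← hc, ENNReal.ofReal_mul hc0, expectation_const_mul] at hhalf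
    calc
      (1 : ℝ≥0∞) = 2 * (1 / 2) := by simp [ENNReal.mul_inv_cancel]
      _ ≤ 2 * (ENNReal.ofReal c *
          expectation (p.iid n) fun w => ENNReal.ofReal (ghostWeight A v w)) := by gcongr
      _ ≤ 2 * (ENNReal.ofReal c * expectation (p.iid n) fun w => maxGhostWeight 𝒜 v w) := by
        gcongr
        exact expectation_mono _ fun w =>
          le_iSup₂ (f := fun A (_ : A ∈ 𝒜) => ENNReal.ofReal (ghostWeight A v w)) A hA
      _ = _ := by rw [ENNReal.ofReal_mul zero_le_two, mul_assoc, ENNReal.ofReal_ofNat]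
  rw [← ENNReal.ofReal_le_ofReal_iff (by positivity)]
  calc
    _ ≤ ENNReal.ofReal (2 * c) * expectation (p.iid n) fun v =>
        expectation (p.iid n) fun w => maxGhostWeight 𝒜 v w := by
      rw [← expectation_const_mul]
      exact ofReal_pr_le_expectation _ hghost
    _ ≤ ENNReal.ofReal (2 * c) * N := by
      gcongr
      exact expectation_maxGhostWeight_le p hN
    _ = _ := by
      rw [← ENNReal.ofReal_natCast, ← ENNReal.ofReal_mul (by positivity)]
      congr 1
      ring

theorem one_third_le_log_three_halves : 1 / 3 ≤ Real.log (3 / 2) := by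
  have := Real.one_sub_inv_le_log_of_pos (x := 3 / 2) (by norm_num)
  norm_num at this ⊢
  exact this

theorem pr_exists_hitCount_le_hitCount_le (p : PMF α) {𝒜 : Set (Set α)} {A₀ : Set α} {N : ℕ}
    {r δ : ℝ} (hδ : 0 < δ) (hδ1 : δ ≤ 1) (hN1 : 1 ≤ N) (hN : growthFunction 𝒜 (2 * n) ≤ N)
    (hA₀ : p.pr A₀ ≤ r) (hn : 3 * Real.log (4 * N / δ) ≤ n * r) :
    (p.iid n).pr {v | ∃ A ∈ 𝒜, 20 * r ≤ p.pr A ∧ hitCount A v ≤ hitCount A₀ v} ≤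
      3 * δ / 4 := by
  have hN1' : (1 : ℝ) ≤ N := mod_cast hN1
  have hlog2 := Real.log_two_gt_d9
  have hlog4 : 2 * Real.log 2 ≤ Real.log (4 * N / δ) := by
    rw [← Real.log_rpow two_pos]
    refine Real.log_le_log (by norm_num) ((le_div_iff₀ hδ).2 ?_)
    norm_num
    nlinarith
  have hA₀' : n * p.pr A₀ ≤ n * r := mul_le_mul_of_nonneg_left hA₀ n.cast_nonneg
  have hexp : Real.exp (-(n * r / 3)) ≤ δ / (4 * N) := by
    rw [← inv_div (4 * (N : ℝ)), ← Real.exp_log (inv_pos.2 (by positivity : 0 < 4 * N / δ)),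
      Real.log_inv]
    exact Real.exp_le_exp.2 (by linarith)
  have htail := (pr_lt_hitCount_le p n A₀ (2 * (n * r))).trans <|
    Real.exp_le_exp.2 (by nlinarith : _ ≤ -(n * r / 3))
  have hdev := (pr_exists_hitCount_le_le p (s := 2 * (n * r)) (r := 20 * r) hN (by linarith)).trans
    (mul_le_mul_of_nonneg_left (Real.exp_le_exp.2
      (by nlinarith [Real.log_two_lt_d9, one_third_le_log_three_halves] : _ ≤ -(n * r / 3)))
      (by positivity))
  calc
    _ ≤ (p.iid n).pr ({v | 2 * (n * r) < hitCount A₀ v} ∪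
        {v | ∃ A ∈ 𝒜, 20 * r ≤ p.pr A ∧ hitCount A v ≤ 2 * (n * r)}) := by
      refine pr_mono _ ?_
      rintro v ⟨⟨A, hA, hr, hle⟩, -⟩
      refine (lt_or_ge (2 * (n * r)) (hitCount A₀ v)).imp_right fun hv => ⟨A, hA, hr, ?_⟩
      exact (Nat.cast_le.2 hle).trans hv
    _ ≤ δ / (4 * N) + 2 * N * (δ / (4 * N)) := by
      grw [pr_union_le, htail, hdev, hexp]
    _ ≤ 3 * δ / 4 := by
      have : δ / (4 * N) ≤ δ / 4 := div_le_div_of_nonneg_left hδ.le (by norm_num) (by linarith)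
      have : 2 * N * (δ / (4 * N)) = δ / 2 := by field_simp; norm_num
      linarith

end UniformDeviation

section NatarajanLemma

variable {α β : Type*}

theorem natarajanShatters_singleton {F : Set (α → β)} {f g : α → β} (hf : f ∈ F) (hg : g ∈ F)
    {x : α} (hx : f x ≠ g x) : NatarajanShatters F {x} := by
  refine ⟨f, g, by simpa using hx, fun B hB => ?_⟩
  rcases Finset.subset_singleton_iff.1 hB with rfl | rfl
  · exact ⟨g, hg, by simp, by simp⟩
  · exact ⟨f, hf, by simp, by simp⟩

theorem NatarajanShatters.card_le {F : Set (α → β)} {d : ℕ} (hd : natarajanDim F = d)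
    {S : Finset α} (h : NatarajanShatters F S) : S.card ≤ d := by
  rw [← Nat.cast_le (α := ℕ∞), ← hd]
  exact le_iSup₂ (f := fun (S : Finset α) (_ : NatarajanShatters F S) => (S.card : ℕ∞)) S h

/-- The functions of `F` with value `b` at `x` that agree on `P` with a function of `F` with
value `a` at `x`: the restriction of such a function to `P` extends to `x` in two ways. -/
def branching (F : Set (α → β)) (P : Finset α) (x : α) (a b : β) : Set (α → β) :=
  {f | f ∈ F ∧ f x = b ∧ ∃ g ∈ F, g x = a ∧ Set.EqOn f g P}

theorem NatarajanShatters.insert_of_branching [DecidableEq α] {F : Set (α → β)} {P S : Finset α}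
    {x : α} (hx : x ∉ P) (hS : S ⊆ P) {a b : β} (hab : a ≠ b)
    (h : NatarajanShatters (branching F P x a b) S) : NatarajanShatters F (insert x S) := by
  obtain ⟨f₀, f₁, hne, hB⟩ := h
  have hxS : ∀ z ∈ S, z ≠ x := fun z hz hzx => hx (hzx ▸ hS hz)
  refine ⟨Function.update f₀ x b, Function.update f₁ x a, ?_, fun B hBS => ?_⟩
  · refine Finset.forall_mem_insert _ _ _ |>.2 ⟨by simpa using hab.symm, fun z hz => ?_⟩
    simpa [hxS z hz] using hne z hz
  obtain ⟨f, ⟨hfF, hfb, g, hgF, hga, hfg⟩, hf₀, hf₁⟩ :=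
    hB (B.erase x) (Finset.subset_insert_iff.1 hBS)
  have hf₀' : ∀ z ∈ B, z ≠ x → f z = f₀ z := fun z hz hzx => hf₀ z (Finset.mem_erase.2 ⟨hzx, hz⟩)
  have hf₁' : ∀ z ∈ S, z ∉ B → f z = f₁ z := fun z hz hzB =>
    hf₁ z hz fun hz' => hzB (Finset.mem_of_mem_erase hz')
  by_cases hxB : x ∈ B
  · refine ⟨f, hfF, fun z hz => ?_, fun z hz hzB => ?_⟩
    · by_cases hzx : z = x
      · simp [hzx, hfb]
      · simpa [hzx] using hf₀' z hz hzx
    · have hzx : z ≠ x := fun hzx => hzB (hzx ▸ hxB)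
      simpa [hzx] using hf₁' z (Finset.mem_of_mem_insert_of_ne hz hzx) hzB
  · refine ⟨g, hgF, fun z hz => ?_, fun z hz hzB => ?_⟩
    · have hzx : z ≠ x := fun hzx => hxB (hzx ▸ hz)
      have hzS := Finset.mem_of_mem_insert_of_ne (hBS hz) hzx
      simpa [hzx, ← hfg (hS hzS)] using hf₀' z hz hzx
    · by_cases hzx : z = x
      · simp [hzx, hga]
      · have hzS := Finset.mem_of_mem_insert_of_ne hz hzx
        simpa [hzx, ← hfg (hS hzS)] using hf₁' z hzS hzB

theorem NatarajanShatters.card_add_one_le_of_branching [DecidableEq α] {F : Set (α → β)}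
    {P S : Finset α} {x : α} {d : ℕ} (hF : ∀ S ⊆ insert x P, NatarajanShatters F S → S.card ≤ d)
    (hx : x ∉ P) (hS : S ⊆ P) {a b : β} (hab : a ≠ b)
    (h : NatarajanShatters (branching F P x a b) S) : S.card + 1 ≤ d := by
  rw [← Finset.card_insert_of_notMem fun hxS => hx (hS hxS)]
  exact hF _ (Finset.insert_subset_insert x hS) (h.insert_of_branching hx hS hab)

/-- `G` consists of functions of `F` and realizes every restriction of a function of `F` to `P`. -/
def IsTraceCover (F : Set (α → β)) (P : Finset α) (G : Finset (α → β)) : Prop :=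
  ↑G ⊆ F ∧ ∀ f ∈ F, ∃ g ∈ G, Set.EqOn f g P

theorem IsTraceCover.insert [DecidableEq α] [Fintype β] [DecidableEq (α → β)]
    {F : Set (α → β)} {P : Finset α} {x : α} {G₀ : Finset (α → β)} {G : β × β → Finset (α → β)}
    (hG₀ : IsTraceCover F P G₀)
    (hG : ∀ c ∈ (Finset.univ : Finset β).offDiag,
      IsTraceCover (branching F P x c.1 c.2) P (G c)) :
    IsTraceCover F (insert x P) (G₀ ∪ Finset.univ.offDiag.biUnion G) := by
  refine ⟨fun g hg => ?_, fun f hf => ?_⟩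
  · rcases Finset.mem_union.1 hg with hg | hg
    · exact hG₀.1 hg
    · obtain ⟨c, hc, hgc⟩ := Finset.mem_biUnion.1 hg
      exact ((hG c hc).1 hgc).1
  · obtain ⟨g, hg, hfg⟩ := hG₀.2 f hf
    simp only [Finset.coe_insert, Set.EqOn, Set.forall_mem_insert]
    by_cases hgx : g x = f x
    · exact ⟨g, Finset.mem_union_left _ hg, hgx.symm, hfg⟩
    · have hc : (g x, f x) ∈ (Finset.univ : Finset β).offDiag := by simpa using hgx
      obtain ⟨g', hg', hfg'⟩ := (hG _ hc).2 f ⟨hf, rfl, g, hG₀.1 hg, rfl, hfg⟩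
      exact ⟨g', Finset.mem_union_right _ (Finset.mem_biUnion.2 ⟨_, hc, hg'⟩),
        ((hG _ hc).1 hg').2.1.symm, hfg'⟩

theorem exists_isTraceCover_card_le_one {F : Set (α → β)} {P : Finset α}
    (h : ∀ f ∈ F, ∀ g ∈ F, Set.EqOn f g P) : ∃ G, IsTraceCover F P G ∧ G.card ≤ 1 := by
  rcases F.eq_empty_or_nonempty with rfl | ⟨g, hg⟩
  · exact ⟨∅, by simp [IsTraceCover], by simp⟩
  · exact ⟨{g}, ⟨by simpa using hg, fun f hf => ⟨g, by simp, h f hf g hg⟩⟩, by simp⟩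

/-- Natarajan's lemma. The restrictions to `insert x P` are at most those to `P` and, for each pair
of distinct labels, those of a class of smaller dimension. -/
theorem exists_isTraceCover_card_le [Fintype β] [Nonempty β] (P : Finset α) :
    ∀ (d : ℕ) (F : Set (α → β)), (∀ S ⊆ P, NatarajanShatters F S → S.card ≤ d) →
      ∃ G, IsTraceCover F P G ∧ G.card ≤ ((P.card + 1) * Fintype.card β ^ 2) ^ d := by
  classical
  set k := Fintype.card β
  induction P using Finset.induction_on with
  | empty =>
    intro d F _
    obtain ⟨G, hG, hGcard⟩ := exists_isTraceCover_card_le_one (F := F) (P := ∅) (by simp)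
    have hpos : 0 < k := Fintype.card_pos
    exact ⟨G, hG, hGcard.trans (Nat.one_le_pow _ _ (by positivity))⟩
  | insert x P hx ih =>
    rintro (_ | d) F hF
    · refine exists_isTraceCover_card_le_one fun f hf g hg z hz => ?_
      by_contra hne
      simpa using hF {z} (by simpa using hz) (natarajanShatters_singleton hf hg hne)
    obtain ⟨G₀, hG₀, hG₀card⟩ :=
      ih (d + 1) F fun S hS => hF S (hS.trans (Finset.subset_insert x P))
    choose! G hG hGcard using fun (c : β × β) (hc : c ∈ Finset.univ.offDiag) =>
      ih d (branching F P x c.1 c.2) fun S hS h => Nat.le_of_succ_le_succ <|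
        h.card_add_one_le_of_branching hF hx hS (Finset.mem_offDiag.1 hc).2.2
    refine ⟨_, hG₀.insert hG, ?_⟩
    set K := (P.card + 1) * k ^ 2 with hK
    have hpairs : (Finset.univ : Finset β).offDiag.card ≤ k ^ 2 := by
      rw [Finset.offDiag_card, Finset.card_univ, sq]
      exact Nat.sub_le _ _
    calc
      _ ≤ K ^ (d + 1) + k ^ 2 * K ^ d := by
        grw [Finset.card_union_le, Finset.card_biUnion_le_card_mul _ _ _ hGcard, hG₀card, hpairs]
      _ = K ^ d * (K + k ^ 2) := by ring
      _ ≤ (K + k ^ 2) ^ (d + 1) := by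
        rw [pow_succ]
        exact Nat.mul_le_mul_right _ (Nat.pow_le_pow_left (Nat.le_add_right _ _) d)
      _ = _ := by rw [Finset.card_insert_of_notMem hx, hK, ← Nat.succ_mul]

theorem subsingleton_of_natarajanDim_eq_zero {F : Set (α → β)} (hd : natarajanDim F = 0) :
    F.Subsingleton := by
  intro f hf g hg
  by_contra hne
  obtain ⟨x, hx⟩ := Function.ne_iff.1 hne
  simpa using (natarajanShatters_singleton hf hg hx).card_le (d := 0) (by simpa using hd)

theorem nontrivial_of_natarajanDim_ne_zero {F : Set (α → β)} (hd : natarajanDim F ≠ 0) :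
    Nontrivial β := by
  by_contra hβ
  rw [not_nontrivial_iff_subsingleton] at hβ
  refine hd (ENat.iSup_eq_zero.2 fun S => ENat.iSup_eq_zero.2 fun ⟨f₀, f₁, hne, _⟩ => ?_)
  simpa [Finset.eq_empty_iff_forall_notMem] using fun a ha => hne a ha (Subsingleton.elim _ _)

end NatarajanLemma

namespace OracleProg

variable {X Y A α β : Type*}

/-- Every execution of the program makes exactly `r` requests for a response and `v` calls to the
verifier, whatever the oracles return. -/
inductive HasCalls : OracleProg X Y A α → ℕ → ℕ → Prop
  | pure (a : α) : HasCalls (.pure a) 0 0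
  | rollout {x : X} {k : Y → ℝ → OracleProg X Y A α} {r v : ℕ} (h : ∀ y q, HasCalls (k y q) r v) :
      HasCalls (.rollout x k) (r + 1) v
  | verify {x : X} {a : A} {k : Bool → OracleProg X Y A α} {r v : ℕ} (h : ∀ b, HasCalls (k b) r v) :
      HasCalls (.verify x a k) r (v + 1)

theorem HasCalls.bind {p : OracleProg X Y A α} {f : α → OracleProg X Y A β} {r v r' v' : ℕ}
    (hp : HasCalls p r v) (hf : ∀ a, HasCalls (f a) r' v') :
    HasCalls (p.bind f) (r + r') (v + v') := by
  induction hp with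
  | pure a => simpa [OracleProg.bind] using hf a
  | rollout _ ih =>
    rw [add_right_comm]
    exact .rollout ih
  | verify _ ih =>
    rw [add_right_comm]
    exact .verify ih

variable (πref : X → PMF Y) (V : X → A → Bool)

theorem HasCalls.calls_eq_of_mem_support_run {p : OracleProg X Y A α} {r v : ℕ}
    (hp : HasCalls p r v) :
    ∀ e ∈ (p.run πref V).support, e.rollouts = r ∧ e.verifierCalls = v := by
  induction hp with
  | pure a => simp [run]
  | rollout _ ih =>
    simp only [run, PMF.mem_support_bind_iff, PMF.mem_support_map_iff]
    rintro _ ⟨y, -, e, he, rfl⟩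
    exact (ih y _ e he).imp_left (congrArg (· + 1))
  | verify _ ih =>
    simp only [run, PMF.mem_support_map_iff]
    rintro _ ⟨e, he, rfl⟩
    exact (ih _ e he).imp_right (congrArg (· + 1))

/-- The distribution of the result of a program. -/
noncomputable def resultLaw (p : OracleProg X Y A α) : PMF α :=
  (p.run πref V).map Execution.result

@[simp] theorem resultLaw_pure (a : α) :
    (OracleProg.pure a : OracleProg X Y A α).resultLaw πref V = PMF.pure a := by
  simp [resultLaw, run, PMF.pure_map]

@[simp] theorem resultLaw_rollout (x : X) (k : Y → ℝ → OracleProg X Y A α) :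
    (OracleProg.rollout x k).resultLaw πref V =
      (πref x).bind fun y => (k y (πref x y).toReal).resultLaw πref V := by
  simp only [resultLaw, run, PMF.map_bind, PMF.map_comp]
  rfl

@[simp] theorem resultLaw_verify (x : X) (a : A) (k : Bool → OracleProg X Y A α) :
    (OracleProg.verify x a k).resultLaw πref V = (k (V x a)).resultLaw πref V := by
  simp only [resultLaw, run, PMF.map_comp]
  rfl

theorem resultLaw_bind (p : OracleProg X Y A α) (f : α → OracleProg X Y A β) :
    (p.bind f).resultLaw πref V =
      (p.resultLaw πref V).bind fun a => (f a).resultLaw πref V := by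
  induction p with
  | pure a => simp [bind]
  | rollout x k ih => simp [bind, ih]
  | verify x a k ih => simp [bind, ih]

end OracleProg

section RejectionSampling

variable {Tok : Type*} {X : Set (TokenString Tok)} {T : ℕ} [NeZero T]

theorem hasCalls_rejectionSample (C : ℝ) (x : X) (m : ℕ) :
    (rejectionSample (T := T) C x m).HasCalls m m := by
  induction m with
  | zero => exact .pure _
  | succ m ih => exact .rollout fun _ _ => .verify fun _ => ih.bind fun _ => .pure _

theorem hasCalls_rejectionSampleAll (C : ℝ) (m : ℕ) : ∀ {n : ℕ} (xs : Fin n → X),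
    (rejectionSampleAll (T := T) C m xs).HasCalls (n * m) (n * m)
  | 0, _ => by
    rw [Nat.zero_mul]
    exact .pure _
  | n + 1, xs => by
    rw [Nat.succ_mul, Nat.add_comm (n * m)]
    exact (hasCalls_rejectionSample C (xs 0) m).bind fun _ =>
      (hasCalls_rejectionSampleAll C m fun i => xs i.succ).bind fun _ => .pure _

theorem hasCalls_rlFineTune {n : ℕ}
    (erm : (Fin n → X) → (Fin n → Finset (Response Tok T)) → NextTokenModel Tok)
    (C δ : ℝ) (xs : Fin n → X) : (rlFineTune erm C δ xs).HasCalls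
      (n * rolloutsPerPrompt n C δ) (n * rolloutsPerPrompt n C δ) :=
  (hasCalls_rejectionSampleAll C _ xs).bind fun _ => .pure _

theorem rolloutsPerPrompt_le {n : ℕ} {C δ : ℝ} (hn : 2 ≤ n) (hC : 1 ≤ C) (hδ : 0 < δ)
    (hδ1 : δ ≤ 1) : (rolloutsPerPrompt n C δ : ℝ) ≤ 5 * (C * Real.log (n * C / δ)) := by
  have hn' : (2 : ℝ) ≤ n := mod_cast hn
  have hlog2 := Real.log_two_gt_d9
  have hlog : Real.log 2 ≤ Real.log (n * C / δ) := by
    refine Real.log_le_log two_pos ((le_div_iff₀ hδ).2 ?_)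
    nlinarith
  have hlog4 : Real.log (4 * n * C / δ) = 2 * Real.log 2 + Real.log (n * C / δ) := by
    rw [show 4 * (n : ℝ) * C / δ = 2 ^ 2 * (n * C / δ) by ring,
      Real.log_mul (by norm_num) (by positivity), Real.log_pow, Nat.cast_two]
  have hceil : (rolloutsPerPrompt n C δ : ℝ) < C * Real.log (4 * n * C / δ) + 1 := by
    refine Nat.ceil_lt_add_one (mul_nonneg (by linarith) ?_)
    linarith
  rw [hlog4] at hceil
  nlinarith

variable (πref : X → PMF (Response Tok T)) (V : X → Tok → Bool)

theorem calls_le_of_mem_support_rlFineTuneLaw (ρ : PMF X) {n : ℕ}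
    (erm : (Fin n → X) → (Fin n → Finset (Response Tok T)) → NextTokenModel Tok) {C δ : ℝ}
    (hn : 2 ≤ n) (hC : 1 ≤ C) (hδ : 0 < δ) (hδ1 : δ ≤ 1) :
    ∀ e ∈ (rlFineTuneLaw ρ πref V erm C δ).support,
      (e.rollouts : ℝ) ≤ 5 * (n * C * Real.log (n * C / δ)) ∧
      (e.verifierCalls : ℝ) ≤ 5 * (n * C * Real.log (n * C / δ)) := by
  intro e he
  obtain ⟨xs, -, he⟩ := (PMF.mem_support_bind_iff _ _ _).1 he
  obtain ⟨hrollouts, hverifierCalls⟩ :=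
    (hasCalls_rlFineTune erm C δ xs).calls_eq_of_mem_support_run πref V e he
  have hle : ((n * rolloutsPerPrompt n C δ : ℕ) : ℝ) ≤ 5 * (n * C * Real.log (n * C / δ)) := by
    push_cast
    linarith [mul_le_mul_of_nonneg_left (rolloutsPerPrompt_le hn hC hδ hδ1)
      (Nat.cast_nonneg (α := ℝ) n)]
  exact ⟨hrollouts ▸ hle, hverifierCalls ▸ hle⟩

/-- The responses that rejection sampling on the prompt `x` may return: those with a correct answer
and with probability at least `C⁻¹` under the reference model. -/
def acceptedResponses (C : ℝ) (x : X) : Set (Response Tok T) :=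
  {y | C⁻¹ ≤ (πref x y).toReal ∧ V x y.answer = true}

theorem encard_acceptedResponses_le {C : ℝ} (hC : 0 < C) (x : X) :
    (acceptedResponses πref V C x).encard ≤ ⌊C⌋₊ :=
  (Set.encard_le_encard fun _ hy => hy.1).trans (encard_setOf_inv_le_apply_le (πref x) hC)

open Classical in
theorem resultLaw_rejectionSample_succ (C : ℝ) (x : X) (m : ℕ) :
    (rejectionSample C x (m + 1)).resultLaw πref V =
      (πref x).bind fun y => ((rejectionSample C x m).resultLaw πref V).map fun D =>
        if y ∈ acceptedResponses πref V C x then insert y D else D := by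
  simp only [rejectionSample, OracleProg.resultLaw_rollout, OracleProg.resultLaw_verify,
    OracleProg.resultLaw_bind, OracleProg.resultLaw_pure]
  exact congrArg _ (funext fun y => congrArg _ (funext fun D =>
    congrArg PMF.pure (if_congr Iff.rfl rfl rfl)))

theorem subset_acceptedResponses_of_mem_support (C : ℝ) (x : X) (m : ℕ) :
    ∀ D ∈ ((rejectionSample C x m).resultLaw πref V).support,
      (D : Set (Response Tok T)) ⊆ acceptedResponses πref V C x := by
  classical
  induction m with
  | zero => simp [rejectionSample]
  | succ m ih =>
    simp only [resultLaw_rejectionSample_succ, PMF.mem_support_bind_iff, PMF.mem_support_map_iff]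
    rintro _ ⟨y, -, D, hD, rfl⟩
    split_ifs with hy
    · rw [Finset.coe_insert]
      exact Set.insert_subset hy (ih D hD)
    · exact ih D hD

theorem pr_notMem_rejectionSample_le_pow {C : ℝ} {x : X} {y : Response Tok T}
    (hy : y ∈ acceptedResponses πref V C x) (m : ℕ) :
    ((rejectionSample C x m).resultLaw πref V).pr {D | y ∉ D} ≤
      (πref x).pr {y}ᶜ ^ m := by
  classical
  induction m with
  | zero => exact pr_le_one _ _
  | succ m ih =>
    rw [resultLaw_rejectionSample_succ, pow_succ]
    have hdraw : ∀ z ≠ y, (((rejectionSample C x m).resultLaw πref V).map fun D =>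
        if z ∈ acceptedResponses πref V C x then insert z D else D).pr {D | y ∉ D} ≤
          (πref x).pr {y}ᶜ ^ m := fun z hz => by
      rw [pr_map]
      refine (pr_mono _ ?_).trans ih
      rintro D ⟨hD, -⟩
      by_cases hz' : z ∈ acceptedResponses πref V C x <;> simpa [hz', Ne.symm hz] using hD
    have hfound : (((rejectionSample C x m).resultLaw πref V).map fun D =>
        if y ∈ acceptedResponses πref V C x then insert y D else D).pr {D | y ∉ D} = 0 := by
      simp [pr_map, hy]
    refine (pr_bind_le _ _ {y}ᶜ (pow_nonneg (pr_nonneg _ _) m) le_rfl hdraw fun z hz => ?_).trans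
      (by simp)
    obtain rfl : z = y := not_not.1 hz
    exact hfound.le

theorem pr_notMem_rejectionSample_le_exp {C : ℝ} {x : X} {y : Response Tok T}
    (hy : y ∈ acceptedResponses πref V C x) (m : ℕ) :
    ((rejectionSample C x m).resultLaw πref V).pr {D | y ∉ D} ≤ Real.exp (-(m * C⁻¹)) := by
  have hmiss : (πref x).pr {y}ᶜ ≤ Real.exp (-C⁻¹) := by
    have hsum := pr_add_pr_compl (πref x) {y}
    rw [pr_singleton] at hsum
    linarith [hy.1, Real.add_one_le_exp (-C⁻¹)]
  rw [← mul_neg, Real.exp_nat_mul]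
  exact (pr_notMem_rejectionSample_le_pow πref V hy m).trans
    (pow_le_pow_left₀ (pr_nonneg _ _) hmiss m)

theorem pr_rejectionSample_ne_le {C : ℝ} (hC : 0 < C) (x : X) (m : ℕ) :
    ((rejectionSample C x m).resultLaw πref V).pr {D | ↑D ≠ acceptedResponses πref V C x} ≤
      C * Real.exp (-(m * C⁻¹)) := by
  have hencard := encard_acceptedResponses_le πref V hC x
  obtain ⟨accepted, haccepted⟩ := (Set.finite_of_encard_le_coe hencard).exists_finset_coe
  rw [← haccepted, Set.encard_coe_eq_coe_finsetCard, Nat.cast_le] at hencard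
  calc
    _ ≤ ((rejectionSample C x m).resultLaw πref V).pr (⋃ y ∈ accepted, {D | y ∉ D}) := by
      refine pr_mono _ fun D hD => ?_
      obtain ⟨y, hy, hyD⟩ := Set.not_subset.1 fun h =>
        hD.1 ((subset_acceptedResponses_of_mem_support πref V C x m D hD.2).antisymm h)
      rw [← haccepted] at hy
      exact Set.mem_biUnion hy hyD
    _ ≤ ∑ _y ∈ accepted, Real.exp (-(m * C⁻¹)) :=
      (pr_biUnion_finset_le _ _ _).trans <| Finset.sum_le_sum fun y hy =>
        pr_notMem_rejectionSample_le_exp πref V (haccepted ▸ Finset.mem_coe.2 hy) m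
    _ ≤ C * Real.exp (-(m * C⁻¹)) := by
      rw [Finset.sum_const, nsmul_eq_mul]
      gcongr
      exact (Nat.cast_le.2 hencard).trans (Nat.floor_le hC.le)

theorem pr_rejectionSampleAll_ne_le {C : ℝ} (hC : 0 < C) (m : ℕ) : ∀ {n : ℕ} (xs : Fin n → X),
    ((rejectionSampleAll C m xs).resultLaw πref V).pr
        {Ds | ∃ i, ↑(Ds i) ≠ acceptedResponses πref V C (xs i)} ≤
      n * (C * Real.exp (-(m * C⁻¹)))
  | 0, xs => by simp
  | n + 1, xs => by
    rw [rejectionSampleAll, OracleProg.resultLaw_bind, Nat.cast_succ, add_one_mul,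
      add_comm ((n : ℝ) * _)]
    refine pr_bind_le_add _ _
      {D : Finset (Response Tok T) | (D : Set (Response Tok T)) ≠ acceptedResponses πref V C (xs 0)}
      (by positivity) (pr_rejectionSample_ne_le πref V hC (xs 0) m) fun D hD => ?_
    rw [OracleProg.resultLaw_bind]
    simp only [OracleProg.resultLaw_pure]
    refine (pr_map _ _ _).trans_le ((pr_mono _ ?_).trans
      (pr_rejectionSampleAll_ne_le hC m fun i => xs i.succ))
    rintro Ds ⟨hDs, -⟩
    rcases Fin.exists_fin_succ.1 hDs with h0 | hsucc
    · exact absurd h0 hD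
    · exact hsucc

theorem pr_rejectionSampleAll_rolloutsPerPrompt_ne_le {C δ : ℝ} (hC : 0 < C) (hδ : 0 < δ) {n : ℕ}
    (xs : Fin n → X) :
    ((rejectionSampleAll C (rolloutsPerPrompt n C δ) xs).resultLaw πref V).pr
        {Ds | ∃ i, ↑(Ds i) ≠ acceptedResponses πref V C (xs i)} ≤ δ / 4 := by
  rcases n.eq_zero_or_pos with rfl | hn
  · simpa using by positivity
  have hlog : Real.log (4 * n * C / δ) ≤ rolloutsPerPrompt n C δ * C⁻¹ := by
    rw [← div_eq_mul_inv, le_div_iff₀ hC, mul_comm]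
    exact Nat.le_ceil _
  calc
    _ ≤ n * (C * Real.exp (-(rolloutsPerPrompt n C δ * C⁻¹))) :=
      pr_rejectionSampleAll_ne_le πref V hC _ xs
    _ ≤ n * (C * Real.exp (-Real.log (4 * n * C / δ))) := by gcongr
    _ = δ / 4 := by
      rw [Real.exp_neg, Real.exp_log (by positivity)]
      field_simp

end RejectionSampling

section Decoding

variable {Tok : Type*} {T : ℕ}

/-- The prompt `x` followed by the first `t` tokens of the response `y`: what a model reads before
it decides on the token with index `t`. -/
def prefixString (x : TokenString Tok) (y : Response Tok T) (t : ℕ) : TokenString Tok :=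
  x.append (Stream'.Seq.ofList ((List.ofFn y).take t))

theorem prefixString_congr (x : TokenString Tok) {y z : Response Tok T} {t : ℕ}
    (h : ∀ s : Fin T, s < t → y s = z s) : prefixString x y t = prefixString x z t := by
  refine congrArg (x.append <| Stream'.Seq.ofList ·) (List.ext_getElem (by simp) fun s hs _ => ?_)
  obtain ⟨hst, hsT⟩ : s < t ∧ s < T := by simpa using hs
  simpa using h ⟨s, hsT⟩ hst

theorem decode_eq_take_ofFn_cot (π : NextTokenModel Tok) (x : TokenString Tok) :
    ∀ t ≤ T, π.decode x t = (List.ofFn (π.cot T x)).take t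
  | 0, _ => by simp [NextTokenModel.decode]
  | t + 1, ht => by
    rw [NextTokenModel.decode, List.take_add_one,
      ← decode_eq_take_ofFn_cot π x t (Nat.le_of_succ_le ht)]
    simp [Nat.lt_of_succ_le ht, NextTokenModel.cot]

theorem apply_prefixString_cot (π : NextTokenModel Tok) (x : TokenString Tok) (t : Fin T) :
    π (prefixString x (π.cot T x) t) = π.cot T x t := by
  rw [prefixString, ← decode_eq_take_ofFn_cot π x t t.2.le, NextTokenModel.cot]

theorem cot_eq_iff {π : NextTokenModel Tok} {x : TokenString Tok} {y : Response Tok T} :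
    π.cot T x = y ↔ ∀ t : Fin T, π (prefixString x y t) = y t := by
  refine ⟨?_, fun h => funext fun t => ?_⟩
  · rintro rfl
    exact apply_prefixString_cot π x
  · induction t using WellFoundedLT.induction with
    | ind t ih => rw [← h t, ← apply_prefixString_cot π x t, prefixString_congr x ih]

theorem cot_mem_of_apply_prefixString_eq {π π' : NextTokenModel Tok} {x : TokenString Tok}
    {D : Set (Response Tok T)}
    (h : ∀ y ∈ D, ∀ t : Fin T, π (prefixString x y t) = π' (prefixString x y t))
    (hD : π.cot T x ∈ D) : π'.cot T x ∈ D := by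
  rwa [cot_eq_iff.2 fun t => (h _ hD t).symm.trans (apply_prefixString_cot π x t)]

variable {X : Set (TokenString Tok)}

/-- The prompts on which the chain of thought of `π` lies outside the prescribed set of responses.
The indicator loss of `RLFineTune` counts the visits of the sample to such a set. -/
def missSet (D : X → Set (Response Tok T)) (π : NextTokenModel Tok) : Set X :=
  {x | π.cot T x ∉ D x}

theorem missSet_inter_eq_of_apply_prefixString_eq {D : X → Set (Response Tok T)} {S : Set X}
    {π π' : NextTokenModel Tok}
    (h : ∀ x ∈ S, ∀ y ∈ D x, ∀ t : Fin T,
      π (prefixString (x : TokenString Tok) y t) = π' (prefixString (x : TokenString Tok) y t)) :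
    missSet D π ∩ S = missSet D π' ∩ S := by
  ext x
  refine and_congr_left fun hx => not_congr
    ⟨cot_mem_of_apply_prefixString_eq (h x hx), cot_mem_of_apply_prefixString_eq ?_⟩
  exact fun y hy t => (h x hx y hy t).symm

theorem exists_finset_prefixString_mem {D : X → Set (Response Tok T)} {c : ℕ}
    (hD : ∀ x, (D x).encard ≤ c) (S : Finset X) :
    ∃ P : Finset (TokenString Tok), P.card ≤ S.card * (c * T) ∧
      ∀ x ∈ S, ∀ y ∈ D x, ∀ t : Fin T, prefixString (x : TokenString Tok) y t ∈ P := by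
  classical
  choose E hE using fun x => (Set.finite_of_encard_le_coe (hD x)).exists_finset_coe
  have hEcard : ∀ x, (E x).card ≤ c := fun x => by
    rw [← Nat.cast_le (α := ℕ∞), ← Set.encard_coe_eq_coe_finsetCard, hE]
    exact hD x
  refine ⟨S.biUnion fun x => (E x).biUnion fun y =>
    Finset.univ.image fun t : Fin T => prefixString (x : TokenString Tok) y t, ?_, ?_⟩
  · refine Finset.card_biUnion_le_card_mul _ _ _ fun x _ =>
      (Finset.card_biUnion_le_card_mul _ _ T fun y _ => ?_).trans
        (Nat.mul_le_mul_right T (hEcard x))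
    exact Finset.card_image_le.trans_eq (Finset.card_fin T)
  · intro x hx y hy t
    rw [← hE x, Finset.mem_coe] at hy
    exact Finset.mem_biUnion.2 ⟨x, hx, Finset.mem_biUnion.2
      ⟨y, hy, Finset.mem_image_of_mem _ (Finset.mem_univ t)⟩⟩

theorem growthFunction_missSet_le [Fintype Tok] [Nonempty Tok] {M : Set (NextTokenModel Tok)}
    {d c : ℕ} (hd : natarajanDim M = d) {D : X → Set (Response Tok T)}
    (hD : ∀ x, (D x).encard ≤ c) (m : ℕ) :
    growthFunction (missSet D '' M) m ≤
      (((m * (c * T) + 1) * Fintype.card Tok ^ 2) ^ d : ℕ) := by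
  classical
  refine iSup₂_le fun S hS => ?_
  obtain ⟨P, hPcard, hP⟩ := exists_finset_prefixString_mem hD S
  obtain ⟨G, ⟨-, hG⟩, hGcard⟩ := exists_isTraceCover_card_le P d M fun S _ h => h.card_le hd
  have hsubset : (· ∩ (S : Set X)) '' (missSet D '' M) ⊆
      ↑(G.image fun π => missSet D π ∩ (S : Set X)) := by
    rintro _ ⟨_, ⟨π, hπ, rfl⟩, rfl⟩
    obtain ⟨g, hg, hπg⟩ := hG π hπ
    refine Finset.mem_coe.2 (Finset.mem_image.2 ⟨g, hg, ?_⟩)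
    exact missSet_inter_eq_of_apply_prefixString_eq fun x hx y hy t => (hπg (hP x hx y hy t)).symm
  refine (Set.encard_le_encard hsubset).trans ?_
  rw [Set.encard_coe_eq_coe_finsetCard, Nat.cast_le]
  exact Finset.card_image_le.trans <| hGcard.trans <| Nat.pow_le_pow_left
    (Nat.mul_le_mul_right _ (Nat.succ_le_succ (hPcard.trans (Nat.mul_le_mul_right _ hS)))) d

theorem indicatorLoss_eq_hitCount_div {n : ℕ} (π : NextTokenModel Tok) {xs : Fin n → X}
    {Ds : Fin n → Finset (Response Tok T)} {D : X → Set (Response Tok T)}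
    (h : ∀ i, (Ds i : Set (Response Tok T)) = D (xs i)) :
    indicatorLoss π xs Ds = hitCount (missSet D π) xs / n := by
  classical
  have hmem : ∀ i, π.cot T (xs i) ∈ Ds i ↔ xs i ∉ missSet D π := fun i => by
    rw [← Finset.mem_coe, h i]
    exact not_not.symm
  simp only [indicatorLoss, hitCount, hmem, Nat.cast_sum, Set.indicator_apply, ite_not,
    Nat.cast_ite, Nat.cast_zero, Pi.one_apply, Nat.cast_one]

theorem hitCount_missSet_erm_le {M : Set (NextTokenModel Tok)} {n : ℕ}
    {erm : (Fin n → X) → (Fin n → Finset (Response Tok T)) → NextTokenModel Tok}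
    (herm : IsERM M erm) {π : NextTokenModel Tok} (hπ : π ∈ M) {xs : Fin n → X}
    {Ds : Fin n → Finset (Response Tok T)} {D : X → Set (Response Tok T)}
    (hDs : ∀ i, (Ds i : Set (Response Tok T)) = D (xs i)) :
    hitCount (missSet D (erm xs Ds)) xs ≤ hitCount (missSet D π) xs := by
  rcases n.eq_zero_or_pos with rfl | hn
  · simp [hitCount]
  have hloss := (herm xs Ds).2 π hπ
  rw [indicatorLoss_eq_hitCount_div _ hDs, indicatorLoss_eq_hitCount_div _ hDs,
    div_le_div_iff_of_pos_right (Nat.cast_pos.2 hn)] at hloss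
  exact_mod_cast hloss

end Decoding

section Accuracy

variable {Tok : Type*} {X : Set (TokenString Tok)} {T : ℕ} [NeZero T]
  (πref : X → PMF (Response Tok T)) (V : X → Tok → Bool)

theorem pr_missSet_acceptedResponses_le {ρ : PMF X} {πstar : NextTokenModel Tok} {C η : ℝ}
    (hacc : accuracy ρ V (fun x => πstar.outcome T x) = 1)
    (hcov : PartialSeqCoverage ρ πref πstar C η) :
    ρ.pr (missSet (acceptedResponses πref V C) πstar) ≤ η := by
  set covered : Set X := {x | C⁻¹ ≤ (πref x (πstar.cot T x)).toReal}
  set correct : Set X := {x | V x (πstar.outcome T x) = true}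
  have hsubset : missSet (acceptedResponses πref V C) πstar ⊆ coveredᶜ ∪ correctᶜ :=
    fun _ hx => not_and_or.1 hx
  have hcovered : 1 - η ≤ ρ.pr covered := hcov
  have hcorrect : ρ.pr correct = 1 := hacc
  linarith [pr_mono ρ (Set.inter_subset_left.trans hsubset), pr_union_le ρ coveredᶜ correctᶜ,
    pr_add_pr_compl ρ covered, pr_add_pr_compl ρ correct]

theorem one_sub_pr_missSet_le_accuracy (ρ : PMF X) (C : ℝ) (π : NextTokenModel Tok) :
    1 - ρ.pr (missSet (acceptedResponses πref V C) π) ≤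
      accuracy ρ V fun x => π.outcome T x := by
  rw [sub_le_iff_le_add', ← pr_add_pr_compl ρ (missSet (acceptedResponses πref V C) π)]
  gcongr
  exact pr_mono ρ fun x hx => (not_not.1 hx.1).2

theorem one_sub_le_pr_rlFineTuneLaw (ρ : PMF X) {n : ℕ}
    {erm : (Fin n → X) → (Fin n → Finset (Response Tok T)) → NextTokenModel Tok} {C δ b : ℝ}
    (hC : 0 < C) (hδ : 0 < δ) {Q : Set (X → Tok)} {B : Set (Fin n → X)}
    (hB : (ρ.iid n).pr B ≤ b)
    (hQ : ∀ xs ∉ B, ∀ Ds : Fin n → Finset (Response Tok T),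
      (∀ i, (Ds i : Set (Response Tok T)) = acceptedResponses πref V C (xs i)) →
        (fun x : X => (erm xs Ds).outcome T x) ∈ Q) :
    1 - (b + δ / 4) ≤ (rlFineTuneLaw ρ πref V erm C δ).pr {e | e.result ∈ Q} := by
  have hfail : (rlFineTuneLaw ρ πref V erm C δ).pr {e | e.result ∈ Q}ᶜ ≤ b + δ / 4 := by
    refine pr_bind_le_add _ _ B (by positivity) hB fun xs hxs => ?_
    refine (pr_map ((rlFineTune erm C δ xs).run πref V) Execution.result Qᶜ).symm.trans_le ?_
    rw [← OracleProg.resultLaw, rlFineTune, OracleProg.resultLaw_bind]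
    simp only [OracleProg.resultLaw_pure]
    refine (pr_map _ _ _).trans_le ((pr_mono _ ?_).trans
      (pr_rejectionSampleAll_rolloutsPerPrompt_ne_le πref V hC hδ xs))
    rintro Ds ⟨hDs, -⟩
    exact not_forall.1 fun hall => hDs (hQ xs hxs Ds hall)
  linarith [pr_add_pr_compl (rlFineTuneLaw ρ πref V erm C δ) {e | e.result ∈ Q}]

theorem one_sub_le_pr_accuracy_of_growthFunction_le (ρ : PMF X) {n N : ℕ}
    {M : Set (NextTokenModel Tok)}
    {erm : (Fin n → X) → (Fin n → Finset (Response Tok T)) → NextTokenModel Tok}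
    {πstar : NextTokenModel Tok} {C δ α : ℝ} (herm : IsERM M erm) (hstar : πstar ∈ M)
    (hC : 0 < C) (hδ : 0 < δ) (hδ1 : δ ≤ 1) (hN1 : 1 ≤ N)
    (hN : growthFunction (missSet (acceptedResponses πref V C) '' M) (2 * n) ≤ N)
    (hα : ρ.pr (missSet (acceptedResponses πref V C) πstar) ≤ α)
    (hn : 3 * Real.log (4 * N / δ) ≤ n * α) :
    1 - δ ≤ (rlFineTuneLaw ρ πref V erm C δ).pr {e | 1 - 20 * α ≤ accuracy ρ V e.result} := by
  have hdeviation := pr_exists_hitCount_le_hitCount_le ρ hδ hδ1 hN1 hN hα hn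
  refine le_of_eq_of_le (by ring) (one_sub_le_pr_rlFineTuneLaw πref V ρ (erm := erm) hC hδ
    (Q := {f | 1 - 20 * α ≤ accuracy ρ V f}) hdeviation fun xs hxs Ds hDs => ?_)
  have hmiss : ρ.pr (missSet (acceptedResponses πref V C) (erm xs Ds)) < 20 * α := by
    by_contra! hge
    exact hxs ⟨_, Set.mem_image_of_mem _ (herm xs Ds).1, hge,
      hitCount_missSet_erm_le herm hstar hDs⟩
  exact (sub_le_sub_left hmiss.le 1).trans (one_sub_pr_missSet_le_accuracy πref V ρ C _)

theorem one_sub_le_pr_accuracy_of_subsingleton (ρ : PMF X) {n : ℕ}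
    {M : Set (NextTokenModel Tok)}
    {erm : (Fin n → X) → (Fin n → Finset (Response Tok T)) → NextTokenModel Tok}
    {πstar : NextTokenModel Tok} {C δ a : ℝ} (hM : M.Subsingleton) (herm : IsERM M erm)
    (hstar : πstar ∈ M) (ha : a ≤ accuracy ρ V fun x => πstar.outcome T x) (hC : 0 < C)
    (hδ : 0 < δ) :
    1 - δ ≤ (rlFineTuneLaw ρ πref V erm C δ).pr {e | a ≤ accuracy ρ V e.result} := by
  refine le_trans ?_ (one_sub_le_pr_rlFineTuneLaw πref V ρ (erm := erm) hC hδ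
    (Q := {f | a ≤ accuracy ρ V f}) (pr_empty (ρ.iid n)).le fun xs _ Ds _ => ?_)
  · linarith
  · rw [hM (herm xs Ds).1 hstar]
    exact ha

end Accuracy

section SampleSize

variable {n T k d : ℕ} {C δ : ℝ}

theorem log_two_le_log_mul (hT : 1 ≤ T) (hk : 2 ≤ k) (hC : 1 ≤ C) :
    Real.log 2 ≤ Real.log (T * k * C) := by
  have hTk : (2 : ℝ) ≤ (T * k : ℕ) := mod_cast Nat.le_mul_of_pos_left k hT |>.trans' hk
  push_cast at hTk
  exact Real.log_le_log two_pos (by nlinarith)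

theorem log_prefix_count_le (hn : 2 ≤ n) (hT : 1 ≤ T) (hk : 2 ≤ k) (hC : 1 ≤ C) :
    Real.log ((2 * n * (⌊C⌋₊ * T) + 1) * k ^ 2) ≤ 8 * (Real.log (T * k * C) * Real.log n) := by
  have hn' : (2 : ℝ) ≤ n := mod_cast hn
  have hT' : (1 : ℝ) ≤ T := mod_cast hT
  have : (0 : ℝ) < k := mod_cast two_pos.trans_le hk
  have hle : (2 * n * (⌊C⌋₊ * T) + 1) * (k : ℝ) ^ 2 ≤ 2 ^ 2 * n * (T * k * C) ^ 2 := by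
    have hfloor : (⌊C⌋₊ : ℝ) ≤ C := Nat.floor_le (by linarith)
    have hCT : 1 ≤ C * T := one_le_mul_of_one_le_of_one_le hC hT'
    have hnCT : 2 ≤ n * (C * T) := by nlinarith
    calc
      _ ≤ (2 * n * (C * T) + 2 * n * (C * T)) * (k : ℝ) ^ 2 := by
        gcongr
        linarith
      _ = 2 ^ 2 * n * (C * T) * k ^ 2 := by ring
      _ ≤ 2 ^ 2 * n * (C * T) ^ 2 * k ^ 2 := by
        gcongr
        exact le_self_pow₀ hCT two_ne_zero
      _ = _ := by ring
  have hlog : Real.log (2 ^ 2 * n * (T * k * C) ^ 2) =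
      2 * Real.log 2 + Real.log n + 2 * Real.log (T * k * C) := by
    rw [Real.log_mul (by positivity) (by positivity), Real.log_mul (by positivity) (by positivity),
      Real.log_pow, Real.log_pow, Nat.cast_two]
  refine (Real.log_le_log (by positivity) hle).trans (hlog.trans_le ?_)
  have hlog2 := Real.log_two_gt_d9
  have hlogn : Real.log 2 ≤ Real.log n := Real.log_le_log two_pos hn'
  have hlogTkC := log_two_le_log_mul hT hk hC
  nlinarith [mul_nonneg (sub_nonneg.2 hlogTkC) (sub_nonneg.2 hlogn)]

theorem three_mul_log_le (hd : d ≠ 0) (hn : 2 ≤ n) (hT : 1 ≤ T) (hk : 2 ≤ k) (hC : 1 ≤ C)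
    (hδ : 0 < δ) (hδ1 : δ ≤ 1) :
    3 * Real.log (4 * (((2 * n * (⌊C⌋₊ * T) + 1) * k ^ 2) ^ d : ℕ) / δ) ≤
      33 * (d * Real.log (T * k * C) * Real.log n + Real.log (1 / δ)) := by
  have hd' : (1 : ℝ) ≤ d := mod_cast Nat.one_le_iff_ne_zero.2 hd
  have hlog2 := Real.log_two_gt_d9
  have hlogn : Real.log 2 ≤ Real.log n := Real.log_le_log two_pos (mod_cast hn)
  have hlogTkC := log_two_le_log_mul hT hk hC
  have hlogδ : 0 ≤ Real.log (1 / δ) := Real.log_nonneg ((one_le_div hδ).2 hδ1)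
  have hlog4 : 2 * Real.log 2 ≤ 3 * (d * Real.log (T * k * C) * Real.log n) := by
    calc
      _ ≤ 3 * (1 * Real.log 2 * Real.log 2) := by nlinarith
      _ ≤ _ := by
        have : 0 ≤ Real.log (T * k * C) := by linarith
        gcongr
  have hcount := mul_le_mul_of_nonneg_left (log_prefix_count_le hn hT hk hC) (Nat.cast_nonneg d)
  push_cast
  rw [mul_div_assoc, div_eq_mul_one_div _ δ, Real.log_mul (by norm_num) (by positivity),
    Real.log_mul (by positivity) (by positivity), Real.log_pow,
    show (4 : ℝ) = 2 ^ 2 by norm_num, Real.log_pow, Nat.cast_two]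
  linarith

end SampleSize

theorem mainTheorem3 :
    ∃ C₁ C₂ C₃ : ℝ, 0 < C₁ ∧ 0 < C₂ ∧ 0 < C₃ ∧
      ∀ (Tok : Type*) [Fintype Tok] (X : Set (TokenString Tok)) (T : ℕ) [NeZero T]
        (ρ : PMF X) (V : X → Tok → Bool) (M : Set (NextTokenModel Tok)) (d : ℕ)
        (πstar : NextTokenModel Tok) (πref : X → PMF (Response Tok T))
        (Cseq η ε δ : ℝ) (n : ℕ)
        (erm : (Fin n → X) → (Fin n → Finset (Response Tok T)) → NextTokenModel Tok),
        natarajanDim M = d →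
        πstar ∈ M →
        accuracy ρ V (fun x => πstar.outcome T x) = 1 →
        1 ≤ Cseq →
        PartialSeqCoverage ρ πref πstar Cseq η →
        0 < ε → ε < 1 → 0 < δ → δ < 1 →
        IsERM M erm →
        2 ≤ n →
        C₁ * ((d * Real.log (T * Fintype.card Tok * Cseq) * Real.log n + Real.log (1 / δ)) / ε)
          ≤ n →
        1 - δ ≤ (rlFineTuneLaw ρ πref V erm Cseq δ).pr
            {e | 1 - C₂ * (ε + η) ≤ accuracy ρ V e.result} ∧
        ∀ e ∈ (rlFineTuneLaw ρ πref V erm Cseq δ).support,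
          (e.rollouts : ℝ) ≤ C₃ * (n * Cseq * Real.log (n * Cseq / δ)) ∧
          (e.verifierCalls : ℝ) ≤ C₃ * (n * Cseq * Real.log (n * Cseq / δ)) := by
  refine ⟨33, 20, 5, by norm_num, by norm_num, by norm_num, ?_⟩
  intro Tok _ X T _ ρ V M d πstar πref C η ε δ n erm hd hstar hacc hC hcov hε _ hδ hδ1 herm hn
    hsize
  refine ⟨?_, calls_le_of_mem_support_rlFineTuneLaw πref V ρ erm hn hC hδ hδ1.le⟩
  have hC0 : 0 < C := one_pos.trans_le hC
  have hmiss := pr_missSet_acceptedResponses_le πref V hacc hcov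
  have hη : 0 ≤ η := (pr_nonneg _ _).trans hmiss
  rcases eq_or_ne d 0 with rfl | hd0
  · exact one_sub_le_pr_accuracy_of_subsingleton πref V ρ
      (subsingleton_of_natarajanDim_eq_zero (by simpa using hd)) herm hstar (by linarith) hC0 hδ
  have : Nontrivial Tok := nontrivial_of_natarajanDim_ne_zero (F := M) (by simpa [hd] using hd0)
  refine one_sub_le_pr_accuracy_of_growthFunction_le πref V ρ herm hstar hC0 hδ hδ1.le
    (Nat.one_le_pow _ _ (by positivity))
    (growthFunction_missSet_le hd (encard_acceptedResponses_le πref V hC0) (2 * n))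
    (by linarith) ?_
  calc
    _ ≤ 33 * (d * Real.log (T * Fintype.card Tok * C) * Real.log n + Real.log (1 / δ)) :=
      three_mul_log_le hd0 hn NeZero.one_le Fintype.one_lt_card hC hδ hδ1.le
    _ ≤ n * ε := by rwa [← mul_div_assoc, div_le_iff₀ hε] at hsize
    _ ≤ n * (ε + η) := by
      gcongr
      linarith
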